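/- Consider a recurrent task given by a finite directed acyclic graph whose vertices $v$ have worst-case execution times $c(v)\ge 0$, with period $T$ and relative deadline $D\le T$ (consecutive releases are at least $T$ apart). Let $C=\sum_v c(v)$, let $L<D$ be the maximum of $\sum_{v\in\pi}c(v)$ over all directed paths $\pi$, suppose the task is heavy, i.e. $C/D>1$, and let $\gamma=\frac{C-L}{D-L}$ be its minimal capacity requirement. The task is executed on container tasks with load bounds $\delta_1\ge\dots\ge\delta_m$ (a dedicated processor is a container task of load bound $1$) by the following dispatcher. A vertex of the current release (the earliest unfinished one) is eligible once the release has occurred and all predecessors of the vertex in that release are finished. Whenever there are both an eligible vertex and an empty container task, an arbitrary eligible vertex $v$ is put, at the current time $t$, into an empty container task $p$ with the largest load bound $\delta_p$. Let $d'$ be the earliest absolute deadline of the occupied container tasks with load bound strictly larger than $\delta_p$ ($d'=\infty$ if there are none). If $t+c(v)/\delta_p<d'$, then $p$ is occupied by $v$ until the absolute deadline $t+c(v)/\delta_p$. Otherwise $v$ is split into $v'$ with $c(v')=(d'-t)\delta_p$ and a successor $v''$ of $v'$ with $c(v'')=c(v)-c(v')$; $p$ is occupied by $v'$ until the absolute deadline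 $d'$, and $v''$ remains to be dispatched. A container task becomes empty exactly at its absolute deadline, and every container task finishes its assigned workload no later than its absolute deadline. A container task of load bound $0$ is never used. The task is schedulable on these container tasks if, in every such execution, each release is finished within $D$ time units. Let $\delta',\delta''\ge 0$ satisfy \[ \delta'+\delta''=\gamma-\lfloor\gamma\rfloor,\qquad \delta'\ \ge\ \max\left(\frac{\gamma-\lfloor\gamma\rfloor}{2},\ \frac{\gamma-\lfloor\gamma\rfloor}{\gamma}\right), \] and take $m=\lfloor\gamma\rfloor+2$ container tasks: $\lfloor\gamma\rfloor$ with load bound $1$ (the dedicated processors) and two with load bounds $\delta'$ and $\delta''$. Put $S_x=\sum_{j\le x}\delta_j$ for the load bounds in non-increasing order. Then the uniformity is \[ \lambda=\max_{1\le x\le m}\frac{S_m-S_x}{\delta_x}=\gamma-1 \] (terms with $\delta_x=0$ count as $0$), the response-time bound is $\frac{C+\lambda L}{S_m}=D$, and the task is schedulable on these container tasks. -/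

import Mathlib

/-! Time, execution times, speeds and load bounds are real numbers. -/

namespace SemiFed

/-- A recurrent DAG task with vertex set `V`: precedence edges, worst-case execution times,
period and constrained relative deadline. -/
structure DAGTask (V : Type*) where
  edge : V → V → Prop
  acyclic : ∀ v, ¬ Relation.TransGen edge v v
  wcet : V → ℝ
  wcet_nonneg : ∀ v, 0 ≤ wcet v
  period : ℝ
  deadline : ℝ
  deadline_le_period : deadline ≤ period

namespace DAGTask

variable {V : Type*}

/-- `C`, the total worst-case execution time of all vertices. -/
noncomputable def totalWork [Fintype V] (τ : DAGTask V) : ℝ := ∑ v, τ.wcet v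

/-- The total worst-case execution times of the directed paths of the DAG. -/
def pathWorks (τ : DAGTask V) : Set ℝ :=
  {x | ∃ l : List V, l.IsChain τ.edge ∧ x = (l.map τ.wcet).sum}

/-- `L`, the length of a longest path. Paths of a finite acyclic graph do not repeat vertices,
so this is the maximum of a finite set. -/
noncomputable def longestPath (τ : DAGTask V) : ℝ := sSup τ.pathWorks

/-- A heavy task is one whose density `C / D` is larger than `1`. -/
def IsHeavy [Fintype V] (τ : DAGTask V) : Prop := 1 < τ.totalWork / τ.deadline

/-- `γ = (C - L) / (D - L)`, the minimal capacity requirement. -/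
noncomputable def minCapacity [Fintype V] (τ : DAGTask V) : ℝ :=
  (τ.totalWork - τ.longestPath) / (τ.deadline - τ.longestPath)

end DAGTask

/-- The total speed `S_m` of `m` processors. -/
noncomputable def totalSpeed {m : ℕ} (δ : Fin m → ℝ) : ℝ := ∑ j, δ j

/-- The sum `S_x` of the speeds of the `x` fastest processors, for speeds listed in
non-increasing order (the index `x : Fin m` is included). -/
noncomputable def prefixSpeed {m : ℕ} (δ : Fin m → ℝ) (x : Fin m) : ℝ :=
  ∑ j ∈ Finset.Iic x, δ j

/-- The uniformity `max_x (S_m - S_x) / δ_x` of processors whose speeds are listed in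
non-increasing order. If some speeds are `0`, they contribute the value `0`, which does not
change the maximum, as the last positive speed already contributes `0`. -/
noncomputable def uniformity {m : ℕ} [NeZero m] (δ : Fin m → ℝ) : ℝ :=
  Finset.univ.sup' ⟨0, Finset.mem_univ 0⟩
    fun x => (totalSpeed δ - prefixSpeed δ x) / δ x

/-- The load bounds of `n` dedicated processors (container tasks of load bound `1`) followed by
two container tasks with load bounds `a` and `b`. -/
noncomputable def dividedLoads (n : ℕ) (a b : ℝ) : Fin (n + 2) → ℝ :=
  fun p => if p.val < n then 1 else if p.val = n then a else b

/-- One invocation of the dispatcher: at time `start`, a part with worst-case execution time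
`work` of vertex `vertex` of the `inst`-th release is put into container task `container`, which
is occupied until the absolute deadline `deadline`. The part has actually been executed at time
`finish`. If `split` is `true`, then the remainder of the vertex is put back, to be
dispatched later; otherwise the part is all that was left of the vertex. -/
structure Dispatch (V : Type*) (m : ℕ) where
  inst : ℕ
  vertex : V
  container : Fin m
  start : ℝ
  work : ℝ
  deadline : ℝ
  finish : ℝ
  split : Bool

section Dispatcher

variable {V : Type*} {m : ℕ}

/-- After the dispatches `past`, container task `p` is occupied at time `t`. A container task
becomes empty exactly when time reaches its absolute deadline. -/
def Occupied (past : List (Dispatch V m)) (t : ℝ) (p : Fin m) : Prop :=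
  ∃ e ∈ past, e.container = p ∧ e.start ≤ t ∧ t < e.deadline

/-- All dispatched parts of vertex `v` of release `k` have been executed by time `t`. -/
def PartsDone (past : List (Dispatch V m)) (t : ℝ) (k : ℕ) (v : V) : Prop :=
  ∀ e ∈ past, e.inst = k → e.vertex = v → e.finish ≤ t

/-- Vertex `v` of release `k` has been dispatched completely, with no remainder put back. -/
def FullyDispatched (past : List (Dispatch V m)) (k : ℕ) (v : V) : Prop :=
  ∃ e ∈ past, e.inst = k ∧ e.vertex = v ∧ e.split = false

/-- Vertex `v` of release `k` is finished by time `t`. -/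
def Finished (past : List (Dispatch V m)) (t : ℝ) (k : ℕ) (v : V) : Prop :=
  FullyDispatched past k v ∧ PartsDone past t k v

open Classical in
/-- The worst-case execution time of what is left of vertex `v` of release `k`. -/
noncomputable def remaining (τ : DAGTask V) (past : List (Dispatch V m)) (k : ℕ) (v : V) : ℝ :=
  τ.wcet v -
    ((past.filter fun e => decide (e.inst = k ∧ e.vertex = v)).map Dispatch.work).sum

/-- With release times `r`, (what is left of) vertex `v` of release `k` is eligible at time `t`:
release `k` is the current one (it has been released and the previous releases are finished),
the vertex still has to be dispatched, its earlier parts are finished, and its predecessors in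
the same release are finished. -/
def Eligible (τ : DAGTask V) (r : ℕ → ℝ) (past : List (Dispatch V m)) (t : ℝ)
    (k : ℕ) (v : V) : Prop :=
  r k ≤ t ∧ (∀ j < k, ∀ u, Finished past t j u) ∧
    ¬ FullyDispatched past k v ∧ PartsDone past t k v ∧
    ∀ u, τ.edge u v → Finished past t k u

/-- The absolute deadlines of the container tasks that are occupied at time `t` and have a load
bound strictly larger than that of `p`. -/
def fasterDeadlines (δ : Fin m → ℝ) (past : List (Dispatch V m)) (t : ℝ) (p : Fin m) : Set ℝ :=
  {d | ∃ e ∈ past, δ p < δ e.container ∧ e.start ≤ t ∧ t < e.deadline ∧ d = e.deadline}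

/-- After the dispatches `past`, the dispatch `e` follows the dispatching algorithm for container
tasks with load bounds `δ`, and the container task finishes it by the absolute deadline.
A container task of load bound `0` cannot execute anything and is never used. -/
structure IsDispatch (τ : DAGTask V) (δ : Fin m → ℝ) (r : ℕ → ℝ)
    (past : List (Dispatch V m)) (e : Dispatch V m) : Prop where
  /-- An arbitrary eligible vertex is chosen. -/
  eligible : Eligible τ r past e.start e.inst e.vertex
  pos : 0 < δ e.container
  empty : ¬ Occupied past e.start e.container
  /-- Among the empty container tasks one with the largest load bound is chosen. -/
  fastest : ∀ q, ¬ Occupied past e.start q → δ q ≤ δ e.container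
  /-- If every faster occupied container task has a deadline `> t + c / δ_p`, then the whole
  rest is dispatched with deadline `t + c / δ_p`. Otherwise the vertex is split, and its first
  part gets the earliest deadline `d'` of the faster occupied container tasks. -/
  rule :
    (e.split = false ∧
      e.work = remaining τ past e.inst e.vertex ∧
      e.deadline = e.start + e.work / δ e.container ∧
      ∀ d ∈ fasterDeadlines δ past e.start e.container, e.deadline < d) ∨
    (e.split = true ∧
      IsLeast (fasterDeadlines δ past e.start e.container) e.deadline ∧
      e.deadline ≤ e.start + remaining τ past e.inst e.vertex / δ e.container ∧
      e.work = (e.deadline - e.start) * δ e.container)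
  start_le_finish : e.start ≤ e.finish
  finish_le_deadline : e.finish ≤ e.deadline

/-- The dispatches made up to and including time `t`. -/
noncomputable def upTo (log : List (Dispatch V m)) (t : ℝ) : List (Dispatch V m) :=
  log.filter fun e => decide (e.start ≤ t)

/-- `log` is the chronological list of all dispatches that are made up to and including time `H`
in some execution of the task with release times `r`, by the dispatcher, on container tasks
with load bounds `δ` that always finish their assigned workload by its deadline. -/
structure IsExecution (τ : DAGTask V) (δ : Fin m → ℝ) (r : ℕ → ℝ)
    (log : List (Dispatch V m)) (H : ℝ) : Prop where
  sorted : log.Pairwise fun e e' => e.start ≤ e'.start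
  start_le : ∀ e ∈ log, e.start ≤ H
  dispatch : ∀ past e rest, log = past ++ e :: rest → IsDispatch τ δ r past e
  /-- The dispatcher is invoked whenever there exist both an empty container task and an eligible
  vertex: after the dispatches made at time `t`, there are no longer both. -/
  eager : ∀ t ≤ H, ∀ p, 0 < δ p → ¬ Occupied (upTo log t) t p →
    ∀ k v, ¬ Eligible τ r (upTo log t) t k v

/-- The task is schedulable on container tasks with load bounds `δ`: whatever the (sporadic)
release times, the choices of the dispatcher and the actual finishing times within the container
tasks' deadlines, in every execution that has run up to the absolute deadline of a release, each
vertex of that release is finished by then. -/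
def Schedulable (τ : DAGTask V) (δ : Fin m → ℝ) : Prop :=
  ∀ r : ℕ → ℝ, (∀ k, r k + τ.period ≤ r (k + 1)) →
    ∀ (log : List (Dispatch V m)) (H : ℝ), IsExecution τ δ r log H →
      ∀ k, r k + τ.deadline ≤ H → ∀ v, Finished log (r k + τ.deadline) k v

end Dispatcher

end SemiFed

/-! This is Graham's work argument, adapted to processors of different speeds. Let λ be the
uniformity and S the total speed. Suppose some part of release `k` holds its container past `r k +
D`. A path ending in the vertex of that part can be chosen such that, throughout the window of
length D, either every usable container is occupied or a vertex of the path is (`exists_chain`). In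
the first case no speed is lost. In the second case the path vertex sits in some container `q`, all
strictly faster containers are occupied (`occupied_of_lt`), and the lost speed is at most λ `δ q`
(`totalSpeed_le_of_busy`). Integrating over the window, S·D is at most the reserved work plus λ
times the reserved work on the path. It is strictly below C + λL, because the late part sticks out
of the window. So C + λL ≤ S·D rules out late parts (`deadline_le_of_bound`), and induction over
releases gives schedulability.

For the given loads S = γ. The first dedicated processor contributes γ - 1 to the uniformity, and
the condition on δ' says that δ''/δ' is no larger. Finally C + (γ - 1)L = γD is the definition of γ
with denominators cleared. -/

namespace SemiFed

/-! ### Paths of a finite acyclic graph -/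

namespace DAGTask

variable {V : Type*}

theorem wellFounded_edge [Finite V] (τ : DAGTask V) : WellFounded τ.edge := by
  have : Std.Irrefl (Relation.TransGen τ.edge) := ⟨τ.acyclic⟩
  exact Subrelation.wf (fun h => Relation.TransGen.single h)
    (Finite.wellFounded_of_trans_of_irrefl (Relation.TransGen τ.edge))

theorem nodup_of_isChain (τ : DAGTask V) {l : List V} (h : l.IsChain τ.edge) : l.Nodup := by
  have h1 : l.IsChain (Relation.TransGen τ.edge) := h.imp fun _ _ => .single
  refine h1.pairwise.imp ?_
  rintro a _ hab rfl
  exact τ.acyclic a hab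

/-- Vertices on a path are distinct, so C is a bound. Without one, the supremum defining
`longestPath` would take the default value 0. -/
theorem bddAbove_pathWorks [Fintype V] (τ : DAGTask V) : BddAbove τ.pathWorks := by
  classical
  refine ⟨τ.totalWork, ?_⟩
  rintro _ ⟨l, hl, rfl⟩
  rw [← List.sum_toFinset _ (τ.nodup_of_isChain hl)]
  exact Finset.sum_le_univ_sum_of_nonneg τ.wcet_nonneg

theorem sum_le_longestPath [Fintype V] (τ : DAGTask V) {l : List V} (h : l.IsChain τ.edge) :
    (l.map τ.wcet).sum ≤ τ.longestPath :=
  le_csSup τ.bddAbove_pathWorks ⟨l, h, rfl⟩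

theorem longestPath_nonneg [Fintype V] (τ : DAGTask V) : 0 ≤ τ.longestPath := by
  simpa using τ.sum_le_longestPath (l := []) .nil

end DAGTask

/-! ### Speed lost when slow processors idle -/

section Uniformity

variable {m : ℕ} {δ : Fin m → ℝ}

theorem prefixSpeed_le_totalSpeed (hδ : ∀ p, 0 ≤ δ p) (x : Fin m) :
    prefixSpeed δ x ≤ totalSpeed δ :=
  Finset.sum_le_univ_sum_of_nonneg hδ

theorem uniformity_nonneg [NeZero m] (hδ : ∀ p, 0 ≤ δ p) : 0 ≤ uniformity δ :=
  le_trans (div_nonneg (sub_nonneg.2 (prefixSpeed_le_totalSpeed hδ 0)) (hδ 0))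
    (Finset.le_sup' (fun x => (totalSpeed δ - prefixSpeed δ x) / δ x) (Finset.mem_univ 0))

/-- If the processor `q` and all strictly faster ones are busy, then the speed that is lost is at
most the uniformity times the speed of `q`. -/
theorem totalSpeed_le_of_busy [NeZero m] (hanti : Antitone δ) (hδ : ∀ p, 0 ≤ δ p) {B : Finset (Fin m)}
    {q : Fin m} (hq : 0 < δ q) (hqB : q ∈ B) (hB : ∀ p, δ q < δ p → p ∈ B) :
    totalSpeed δ ≤ ∑ p ∈ B, δ p + uniformity δ * δ q := by
  classical
  -- Among ties with `q`, take the first index `x`: everything before it is strictly faster, hence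
  -- in `B`, and `q` itself supplies the speed of `x`.
  obtain ⟨x, hx, hmin⟩ := Finset.exists_min_image (Finset.univ.filter fun p => δ p = δ q) id
    ⟨q, by simp⟩
  simp only [Finset.mem_filter, Finset.mem_univ, true_and, id] at hx hmin
  have hU : totalSpeed δ - prefixSpeed δ x ≤ uniformity δ * δ q := by
    rw [← hx, ← div_le_iff₀ (hx ▸ hq)]
    exact Finset.le_sup' (fun x => (totalSpeed δ - prefixSpeed δ x) / δ x) (Finset.mem_univ x)
  have hfast : ∀ p, p < x → δ q < δ p := fun p hp =>
    lt_of_le_of_ne (hx ▸ hanti hp.le) fun h => absurd (hmin p h.symm) (not_le.2 hp)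
  have hIio : Finset.Iio x ⊆ B.erase q := fun p hp => by
    have h := hfast p (Finset.mem_Iio.1 hp)
    exact Finset.mem_erase.2 ⟨fun h' => by simp [h'] at h, hB p h⟩
  have hP : prefixSpeed δ x ≤ ∑ p ∈ B, δ p := by
    rw [prefixSpeed, ← Finset.Iio_insert, Finset.sum_insert (by simp), hx,
      ← Finset.add_sum_erase _ _ hqB]
    refine add_le_add_right ?_ _
    exact Finset.sum_le_sum_of_subset_of_nonneg hIio fun p _ _ => hδ p
  linarith

end Uniformity

/-! ### Area estimate -/

section Integration

open MeasureTheory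

/-- If rectangles of heights `w i` over the intervals `[a i, b i)` cover height `s` throughout
`[A, B)`, then their total area is at least `s * (B - A)`. -/
theorem mul_le_sum_of_cover {ι : Type*} [Fintype ι] {a b w : ι → ℝ} {s A B : ℝ} (hAB : A ≤ B)
    (h : ∀ t ∈ Set.Ico A B, s ≤ ∑ i, (Set.Ico (a i) (b i)).indicator (fun _ => w i) t) :
    s * (B - A) ≤ ∑ i, w i * max 0 (min (b i) B - max (a i) A) := by
  have hint : ∀ i, IntegrableOn ((Set.Ico (a i) (b i)).indicator fun _ => w i)
      (Set.Ico A B) := fun i =>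
    (integrableOn_const (by simp)).indicator measurableSet_Ico
  have hmono := setIntegral_mono_on (f := fun _ => s) (integrableOn_const (by simp))
    (integrable_finsetSum Finset.univ fun i _ => hint i) measurableSet_Ico
    (fun t ht => by simpa using h t ht)
  rw [integral_finsetSum _ fun i _ => hint i] at hmono
  calc s * (B - A) = ∫ _ in Set.Ico A B, s := by
        rw [setIntegral_const, smul_eq_mul, Real.volume_real_Ico_of_le hAB, mul_comm]
    _ ≤ _ := hmono
    _ = _ := by
        refine Finset.sum_congr rfl fun i _ => ?_
        rw [setIntegral_indicator measurableSet_Ico, setIntegral_const, smul_eq_mul,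
          Set.Ico_inter_Ico, Real.volume_real_Ico, mul_comm, max_comm, max_comm A, min_comm B]

end Integration

/-! ### Work reserved by dispatches -/

section Execution

variable {V : Type*} {m : ℕ} {τ : DAGTask V} {δ : Fin m → ℝ} {r : ℕ → ℝ}
  {log past : List (Dispatch V m)} {e : Dispatch V m} {H t : ℝ} {k : ℕ} {v : V}

theorem IsDispatch.start_le_deadline (h : IsDispatch τ δ r past e) : e.start ≤ e.deadline :=
  h.start_le_finish.trans h.finish_le_deadline

/-- Split or not, a part is the area of its reservation, so work can be counted without knowing the
actual finishing times. -/
theorem IsDispatch.work_eq (h : IsDispatch τ δ r past e) :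
    e.work = δ e.container * (e.deadline - e.start) := by
  obtain ⟨-, -, h1, -⟩ | ⟨-, -, -, h1⟩ := h.rule
  · rw [h1, add_sub_cancel_left, mul_div_cancel₀ _ h.pos.ne']
  · rw [h1, mul_comm]

theorem IsDispatch.work_le (h : IsDispatch τ δ r past e) :
    e.work ≤ remaining τ past e.inst e.vertex := by
  obtain ⟨-, h1, -⟩ | ⟨-, -, h1, h2⟩ := h.rule
  · exact h1.le
  · rw [h2, ← le_div_iff₀ h.pos]
    linarith

/-- This is the purpose of splitting: no part outlasts a faster container that is occupied when the
part starts. -/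
theorem IsDispatch.deadline_le (h : IsDispatch τ δ r past e) {d : ℝ}
    (hd : d ∈ fasterDeadlines δ past e.start e.container) : e.deadline ≤ d := by
  obtain ⟨-, -, -, h1⟩ | ⟨-, h1, -⟩ := h.rule
  · exact (h1 d hd).le
  · exact h1.2 hd

theorem mem_upTo : e ∈ upTo log t ↔ e ∈ log ∧ e.start ≤ t := by
  simp [upTo]

/-- The parts dispatched of a vertex never exceed its worst-case execution time. -/
theorem remaining_nonneg
    (h : ∀ past e rest, log = past ++ e :: rest → IsDispatch τ δ r past e) (k : ℕ) (v : V) :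
    0 ≤ remaining τ log k v := by
  induction log using List.reverseRecOn with
  | nil => simpa [remaining] using τ.wcet_nonneg v
  | append_singleton l e ih =>
    have ih := ih fun past e' rest hl => h past e' (rest ++ [e]) (by simp [hl])
    have hw := (h l e [] rfl).work_le
    by_cases hkv : e.inst = k ∧ e.vertex = v
    · obtain ⟨rfl, rfl⟩ := hkv
      simp only [remaining, List.filter_append, List.map_append, List.sum_append] at hw ⊢
      simp only [and_self, decide_true, List.filter_cons_of_pos, List.filter_nil, List.map_cons,
        List.map_nil, List.sum_cons, List.sum_nil]
      linarith
    · simpa [remaining, List.filter_append, hkv] using ih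

-- `remaining_nonneg` as a sum over log positions, the form in which the area estimate delivers
-- reserved work.
open Classical in
theorem sum_works_le
    (h : ∀ past e rest, log = past ++ e :: rest → IsDispatch τ δ r past e) (k : ℕ) (v : V) :
    (∑ i : Fin log.length, if log[i].inst = k ∧ log[i].vertex = v then log[i].work else 0) ≤
      τ.wcet v := by
  have h1 := remaining_nonneg h k v
  rw [remaining, sub_nonneg] at h1
  convert h1
  refine (Fin.sum_univ_fun_getElem log
    (fun e => if e.inst = k ∧ e.vertex = v then e.work else 0)).trans ?_
  clear h h1
  induction log with
  | nil => simp
  | cons e l ih =>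
    by_cases hkv : e.inst = k ∧ e.vertex = v
    · simp [hkv, ih]
    · simp [hkv, ih]

open Classical in
theorem sum_works_mem_le
    (h : ∀ past e rest, log = past ++ e :: rest → IsDispatch τ δ r past e) (k : ℕ)
    (s : Finset V) :
    (∑ i : Fin log.length, if log[i].inst = k ∧ log[i].vertex ∈ s then log[i].work else 0) ≤
      ∑ v ∈ s, τ.wcet v := by
  refine le_trans (le_of_eq ?_) (Finset.sum_le_sum fun v _ => sum_works_le h k v)
  rw [Finset.sum_comm]
  refine Finset.sum_congr rfl fun i _ => ?_
  by_cases hk : log[i].inst = k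
  · simp only [hk, true_and, Finset.sum_ite_eq]
  · simp only [hk, false_and, if_false, Finset.sum_const_zero]

/-- At time `t`, the deadline of some part of vertex `v` of release `k` is still ahead. -/
def Running (log : List (Dispatch V m)) (t : ℝ) (k : ℕ) (v : V) : Prop :=
  ∃ e ∈ log, e.inst = k ∧ e.vertex = v ∧ e.start ≤ t ∧ t < e.deadline

/-! ### Executions: monotonicity, critical path, response time -/

namespace IsExecution

/-- Relates the list `past` seen by one dispatch to truncation by time: `past` has all strictly
earlier dispatches, but possibly only some of the simultaneous ones. A completely dispatched vertex
has no entries after `past`, since it is no longer eligible. -/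
theorem exists_past (h : IsExecution τ δ r log H) (he : e ∈ log) :
    ∃ past, past ⊆ log ∧ IsDispatch τ δ r past e ∧
      (∀ e' ∈ log, e'.start < e.start → e' ∈ past) ∧ (∀ e' ∈ past, e'.start ≤ e.start) ∧
      ∀ k v, FullyDispatched past k v → ∀ e' ∈ log, e'.inst = k → e'.vertex = v → e' ∈ past := by
  obtain ⟨past, rest, hlog⟩ := List.append_of_mem he
  have hs := h.sorted
  rw [hlog, List.pairwise_append, List.pairwise_cons] at hs
  refine ⟨past, by simp [hlog], h.dispatch _ _ _ hlog, fun e' he' hlt => ?_,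
    fun e' he' => hs.2.2 e' he' e (by simp), fun k v hfull e' he' hk hv => ?_⟩
  · rw [hlog] at he'
    rcases List.mem_append.1 he' with h1 | h1
    · exact h1
    rcases List.mem_cons.1 h1 with rfl | h1
    · exact absurd hlt (lt_irrefl _)
    · exact absurd (hs.2.1.1 e' h1) (not_le.2 hlt)
  · rw [hlog] at he'
    rcases List.mem_append.1 he' with h1 | h1
    · exact h1
    obtain ⟨s, u, hsu⟩ := List.append_of_mem h1
    have h2 := (h.dispatch (past ++ s) e' u (by rw [hlog, hsu, List.append_assoc])).eligible
    obtain ⟨e0, he0, h3⟩ := hfull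
    exact absurd ⟨e0, by simp [he0], by rwa [hk, hv]⟩ h2.2.2.1

theorem exists_isDispatch (h : IsExecution τ δ r log H) (he : e ∈ log) :
    ∃ past, IsDispatch τ δ r past e :=
  let ⟨past, _, hp, _⟩ := h.exists_past he
  ⟨past, hp⟩

theorem not_fullyDispatched (h : IsExecution τ δ r log H) (he : e ∈ log) (ht : t < e.start) :
    ¬ FullyDispatched (upTo log t) e.inst e.vertex := by
  rintro ⟨e', he', h1⟩
  rw [mem_upTo] at he'
  obtain ⟨past, -, hp, hmem, -⟩ := h.exists_past he
  exact hp.eligible.2.2.1 ⟨e', hmem e' he'.1 (he'.2.trans_lt ht), h1⟩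

theorem start_le_of_fullyDispatched (h : IsExecution τ δ r log H) (he : e ∈ log)
    (hf : FullyDispatched (upTo log t) e.inst e.vertex) : e.start ≤ t :=
  not_lt.1 fun hlt => h.not_fullyDispatched he hlt hf

theorem finished_mono (h : IsExecution τ δ r log H) {t' : ℝ} (htt' : t ≤ t')
    (hf : Finished (upTo log t) t k v) : Finished (upTo log t') t' k v := by
  obtain ⟨⟨e0, he0, hk, hv, hsplit⟩, hdone⟩ := hf
  rw [mem_upTo] at he0
  refine ⟨⟨e0, mem_upTo.2 ⟨he0.1, he0.2.trans htt'⟩, hk, hv, hsplit⟩, ?_⟩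
  rintro e he rfl rfl
  rw [mem_upTo] at he
  refine (hdone e (mem_upTo.2 ⟨he.1, ?_⟩) rfl rfl).trans htt'
  exact h.start_le_of_fullyDispatched he.1 ⟨e0, mem_upTo.2 he0, hk, hv, hsplit⟩

/-- A release is dispatched only after the earlier releases have been finished. -/
theorem finished_of_inst_lt (h : IsExecution τ δ r log H) (he : e ∈ log) (hk : k < e.inst)
    (ht : e.start ≤ t) (v : V) : Finished (upTo log t) t k v := by
  obtain ⟨past, hsub, hp, -, hle, hfull⟩ := h.exists_past he
  obtain ⟨hf, hd⟩ := hp.eligible.2.1 k hk v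
  refine ⟨?_, fun e' he' hk' hv' => ?_⟩
  · obtain ⟨e0, he0, h0⟩ := hf
    exact ⟨e0, mem_upTo.2 ⟨hsub he0, (hle e0 he0).trans ht⟩, h0⟩
  · exact (hd e' (hfull k v hf e' (mem_upTo.1 he').1 hk' hv') hk' hv').trans ht

/-- While a container task is occupied, so are all container tasks with a larger load bound. -/
theorem occupied_of_lt (h : IsExecution τ δ r log H) (he : e ∈ log) (hs : e.start ≤ t)
    (hd : t < e.deadline) {p : Fin m} (hp : δ e.container < δ p) : Occupied log t p := by
  obtain ⟨past, hsub, hdis, -⟩ := h.exists_past he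
  -- Already at the start of `e` the faster container was taken, by the choice of the fastest empty
  -- one; its occupant lasts at least as long as `e`.
  obtain ⟨e', he', rfl, h1, h2⟩ : Occupied past e.start p :=
    not_not.1 fun hn => absurd (hdis.fastest p hn) (not_le.2 hp)
  exact ⟨e', hsub he', rfl, h1.trans hs,
    hd.trans_le (hdis.deadline_le ⟨e', he', hp, h1, h2, rfl⟩)⟩

/-- As long as `v` is unfinished, either all container tasks are occupied, or a vertex on a
suitable path that ends in `v` is being executed. -/
theorem exists_chain [Finite V] (h : IsExecution τ δ r log H)
    (hk : ∀ j < k, ∀ u, Finished (upTo log (r k)) (r k) j u) (v : V) :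
    ∃ l : List V, (l ++ [v]).IsChain τ.edge ∧ ∀ t, r k ≤ t → t ≤ H →
      ¬ Finished (upTo log t) t k v →
      (∀ p, 0 < δ p → Occupied log t p) ∨ ∃ u ∈ l ++ [v], Running log t k u := by
  induction v using τ.wellFounded_edge.induction with
  | _ v ih =>
  -- With its predecessors finished and no reservation running, an unfinished `v` is eligible, so
  -- eagerness forbids an empty usable container.
  have hlocal : ∀ t, r k ≤ t → t ≤ H → ¬ Finished (upTo log t) t k v →
      (∀ u, τ.edge u v → Finished (upTo log t) t k u) →
      (∀ p, 0 < δ p → Occupied log t p) ∨ Running log t k v := by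
    intro t hrt htH hnf hpred
    by_contra! hcon
    obtain ⟨⟨p, hp, hocc⟩, hrun⟩ := hcon
    have hparts : PartsDone (upTo log t) t k v := by
      intro e he hek hev
      rw [mem_upTo] at he
      obtain ⟨past, hdis⟩ := h.exists_isDispatch he.1
      by_contra! hlt
      exact hrun ⟨e, he.1, hek, hev, he.2, hlt.trans_le hdis.finish_le_deadline⟩
    refine h.eager t htH p hp (fun ⟨e, he, h1⟩ => hocc ⟨e, (mem_upTo.1 he).1, h1⟩) k v
      ⟨hrt, fun j hj u => h.finished_mono hrt (hk j hj u), fun hf => hnf ⟨hf, hparts⟩, hparts,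
        hpred⟩
  by_cases hpre : ∃ u, τ.edge u v
  · let U : V → Set ℝ := fun u => {t | ¬ Finished (upTo log t) t k u}
    have hlow : ∀ u, IsLowerSet (U u) := fun u t t' htt' ht hf => ht (h.finished_mono htt' hf)
    -- Times at which a vertex is unfinished form a lower set of the line, and such sets are nested.
    -- So a single predecessor `u`, independent of `t`, is unfinished whenever any predecessor is.
    obtain ⟨u, hu, hmax⟩ := Set.Finite.exists_maximalFor U {u | τ.edge u v} (Set.toFinite _) hpre
    obtain ⟨l, hl, hcover⟩ := ih u hu
    refine ⟨l ++ [u], ?_, fun t hrt htH hnf => ?_⟩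
    · rw [List.isChain_append]
      refine ⟨hl, by simp, ?_⟩
      simpa using hu
    · by_cases hpred : ∀ w, τ.edge w v → Finished (upTo log t) t k w
      · exact (hlocal t hrt htH hnf hpred).imp_right fun h1 => ⟨v, by simp, h1⟩
      · push Not at hpred
        obtain ⟨w, hw, hwt⟩ := hpred
        have hut : t ∈ U u := ((hlow u).total (hlow w)).elim (fun h1 => hmax hw h1 hwt)
          fun h1 => h1 hwt
        exact (hcover t hrt htH hut).imp_right fun ⟨x, hx, h1⟩ =>
          ⟨x, List.mem_append_left _ hx, h1⟩
  · push Not at hpre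
    refine ⟨[], by simp, fun t hrt htH hnf => ?_⟩
    simpa using hlocal t hrt htH hnf fun u hu => absurd hu (hpre u)

open Classical in
/-- The speed that is lost at time `t` is compensated by the progress along a path. -/
theorem totalSpeed_le_sum_indicator [NeZero m] (h : IsExecution τ δ r log H)
    (hanti : Antitone δ) (hδ : ∀ p, 0 ≤ δ p)
    (hinst : ∀ e ∈ log, e.start ≤ t → t < e.deadline → e.inst = k) (s : Finset V)
    (hbusy : (∀ p, 0 < δ p → Occupied log t p) ∨ ∃ u ∈ s, Running log t k u) :
    totalSpeed δ ≤ ∑ i : Fin log.length, (Set.Ico log[i].start log[i].deadline).indicator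
      (fun _ => (if log[i].inst = k then δ log[i].container else 0) +
        uniformity δ *
          if log[i].inst = k ∧ log[i].vertex ∈ s then δ log[i].container else 0) t := by
  have hU := uniformity_nonneg hδ
  let I : Finset (Fin log.length) :=
    Finset.univ.filter fun i => t ∈ Set.Ico log[i].start log[i].deadline
  have hI : ∀ e ∈ log, e.start ≤ t → t < e.deadline → ∃ i ∈ I, log[i] = e := by
    intro e he h1 h2
    obtain ⟨i, hi, rfl⟩ := List.getElem_of_mem he
    exact ⟨⟨i, hi⟩, by simp [I, h1, h2], rfl⟩
  have hIk : ∀ i ∈ I, log[i].inst = k := fun i hi =>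
    hinst _ (List.getElem_mem _) (Finset.mem_filter.1 hi).2.1 (Finset.mem_filter.1 hi).2.2
  let B : Finset (Fin m) := I.image fun i => log[i].container
  have hB : ∀ p, Occupied log t p → p ∈ B := by
    rintro p ⟨e, he, rfl, h1, h2⟩
    obtain ⟨i, hi, rfl⟩ := hI e he h1 h2
    exact Finset.mem_image.2 ⟨i, hi, rfl⟩
  -- An inequality suffices here, so it need not be shown that reservations of one container are
  -- disjoint.
  have hBI : ∑ p ∈ B, δ p ≤ ∑ i ∈ I, δ log[i].container :=
    Finset.sum_image_le_of_nonneg fun i _ => hδ _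
  have hnn : ∀ i ∈ I, 0 ≤ if log[i].vertex ∈ s then δ log[i].container else 0 := fun i _ => by
    split_ifs
    exacts [hδ _, le_rfl]
  have hsum : (∑ i : Fin log.length, (Set.Ico log[i].start log[i].deadline).indicator
      (fun _ => (if log[i].inst = k then δ log[i].container else 0) +
        uniformity δ *
          if log[i].inst = k ∧ log[i].vertex ∈ s then δ log[i].container else 0) t) =
      ∑ i ∈ I, δ log[i].container +
        uniformity δ * ∑ i ∈ I, if log[i].vertex ∈ s then δ log[i].container else 0 := by
    simp only [Set.indicator_apply]
    rw [← Finset.sum_filter, Finset.mul_sum, ← Finset.sum_add_distrib]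
    refine Finset.sum_congr rfl fun i hi => ?_
    simp only [hIk i hi, if_true, true_and]
  rw [hsum]
  rcases hbusy with hall | ⟨u, hu, e, he, rfl, rfl, h1, h2⟩
  · have h1 : totalSpeed δ ≤ ∑ p ∈ B, δ p := by
      rw [totalSpeed, ← Finset.sum_subset (Finset.subset_univ B)]
      intro p _ hp
      exact le_antisymm (not_lt.1 fun h0 => hp (hB p (hall p h0))) (hδ p)
    linarith [mul_nonneg hU (Finset.sum_nonneg hnn)]
  · obtain ⟨past, hdis⟩ := h.exists_isDispatch he
    have hle := totalSpeed_le_of_busy hanti hδ (B := B) hdis.pos (hB _ ⟨e, he, rfl, h1, h2⟩)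
      fun p hp => hB p (h.occupied_of_lt he h1 h2 hp)
    obtain ⟨i, hi, rfl⟩ := hI e he h1 h2
    have h3 := Finset.single_le_sum hnn hi
    rw [if_pos hu] at h3
    linarith [mul_le_mul_of_nonneg_left h3 hU]

/-- The response-time bound: no part of a release is occupying a container task after the deadline
of the release. -/
theorem deadline_le_of_bound [Fintype V] [NeZero m] (h : IsExecution τ δ r log H)
    (hanti : Antitone δ) (hδ : ∀ p, 0 ≤ δ p) (hD : 0 ≤ τ.deadline)
    (hbound : τ.totalWork + uniformity δ * τ.longestPath ≤ totalSpeed δ * τ.deadline)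
    (hH : r k + τ.deadline ≤ H)
    (hk : ∀ j < k, ∀ u, Finished (upTo log (r k)) (r k) j u)
    (hprev : ∀ e ∈ log, e.inst < k → e.deadline ≤ r k)
    (hnext : ∀ j, k < j → r k + τ.deadline ≤ r j)
    (he : e ∈ log) (hek : e.inst = k) (hes : e.start ≤ r k + τ.deadline) :
    e.deadline ≤ r k + τ.deadline := by
  classical
  by_contra! hlt
  obtain ⟨l, hl, hcover⟩ := h.exists_chain hk e.vertex
  set s := (l ++ [e.vertex]).toFinset with hs
  have hU := uniformity_nonneg hδ
  have harea := mul_le_sum_of_cover (le_add_of_nonneg_right hD : r k ≤ r k + τ.deadline)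
    (fun t ht => h.totalSpeed_le_sum_indicator (k := k) hanti hδ (t := t) (by
      intro e' he' h1 h2
      obtain ⟨past, hdis⟩ := h.exists_isDispatch he'
      rcases lt_trichotomy e'.inst k with h3 | h3 | h3
      · exact absurd (hprev e' he' h3) (not_le.2 (ht.1.trans_lt h2))
      · exact h3
      · exact absurd (((hnext _ h3).trans hdis.eligible.1).trans h1) (not_le.2 ht.2)) s (by
      -- Once `e` has started it runs through the rest of the window; before that its vertex is not
      -- completely dispatched, so the path covers `t`.
      rcases le_or_gt e.start t with h1 | h1
      · exact .inr ⟨e.vertex, by simp [hs], e, he, hek, rfl, h1, ht.2.trans hlt⟩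
      · obtain h2 | ⟨u, hu, h2⟩ := hcover t ht.1 (ht.2.le.trans hH) fun hf =>
          h.not_fullyDispatched he h1 (hek ▸ hf.1)
        · exact .inl h2
        · exact .inr ⟨u, List.mem_toFinset.2 hu, h2⟩))
  have hov : ∀ i : Fin log.length, max 0 (min log[i].deadline (r k + τ.deadline) -
      max log[i].start (r k)) ≤ log[i].deadline - log[i].start := fun i => by
    obtain ⟨past, hdis⟩ := h.exists_isDispatch (List.getElem_mem i.2)
    exact max_le (sub_nonneg.2 hdis.start_le_deadline)
      (sub_le_sub (min_le_left _ _) (le_max_left _ _))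
  have hwork : ∀ i : Fin log.length,
      log[i].work = δ log[i].container * (log[i].deadline - log[i].start) := fun i => by
    obtain ⟨past, hdis⟩ := h.exists_isDispatch (List.getElem_mem i.2)
    exact hdis.work_eq
  have hpart : ∀ (P : Prop) [Decidable P] (i : Fin log.length),
      (if P then δ log[i].container else 0) * max 0 (min log[i].deadline (r k + τ.deadline) -
        max log[i].start (r k)) ≤ if P then log[i].work else 0 := fun P _ i => by
    split_ifs
    · rw [hwork]
      exact mul_le_mul_of_nonneg_left (hov i) (hδ _)
    · simp
  -- Strictness comes from `e` alone: its reservation has positive speed and is cut off by the end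
  -- of the window.
  have hlt' : (∑ i : Fin log.length, ((if log[i].inst = k then δ log[i].container else 0) +
        uniformity δ *
          if log[i].inst = k ∧ log[i].vertex ∈ s then δ log[i].container else 0) *
        max 0 (min log[i].deadline (r k + τ.deadline) - max log[i].start (r k))) <
      ∑ i : Fin log.length, ((if log[i].inst = k then log[i].work else 0) + uniformity δ *
        if log[i].inst = k ∧ log[i].vertex ∈ s then log[i].work else 0) := by
    refine Finset.sum_lt_sum (fun i _ => ?_) ?_
    · rw [add_mul, mul_assoc]
      exact add_le_add (hpart _ i) (mul_le_mul_of_nonneg_left (hpart _ i) hU)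
    · obtain ⟨i, hi, hie⟩ := List.getElem_of_mem he
      refine ⟨⟨i, hi⟩, Finset.mem_univ _, ?_⟩
      rw [add_mul, mul_assoc]
      refine add_lt_add_of_lt_of_le ?_ (mul_le_mul_of_nonneg_left (hpart _ _) hU)
      rw [hwork]
      simp only [Fin.getElem_fin, hie, hek, if_true]
      obtain ⟨past, hdis⟩ := h.exists_isDispatch he
      refine mul_lt_mul_of_pos_left ?_ hdis.pos
      refine (max_le (sub_nonneg.2 hes) ?_).trans_lt (sub_lt_sub_right hlt e.start)
      exact sub_le_sub (min_le_right _ _) (le_max_left _ _)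
  rw [Finset.sum_add_distrib, ← Finset.mul_sum] at hlt'
  have hC := sum_works_mem_le h.dispatch k Finset.univ
  have hL := (sum_works_mem_le h.dispatch k s).trans_eq
    (List.sum_toFinset _ (τ.nodup_of_isChain hl))
  simp only [Finset.mem_univ, and_true] at hC
  rw [add_sub_cancel_left] at harea
  rw [DAGTask.totalWork] at hbound
  linarith [mul_le_mul_of_nonneg_left (hL.trans (τ.sum_le_longestPath hl)) hU]

end IsExecution

/-- A task is schedulable if the response-time bound is at most the deadline. -/
theorem schedulable_of_bound [Fintype V] [NeZero m]
    (hanti : Antitone δ) (hδ : ∀ p, 0 ≤ δ p) (hpos : 0 < δ 0) (hD : 0 ≤ τ.deadline)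
    (hbound : τ.totalWork + uniformity δ * τ.longestPath ≤ totalSpeed δ * τ.deadline) :
    Schedulable τ δ := by
  intro r hr log H h
  have hmono : Monotone r := monotone_nat_of_le_succ fun n => by
    linarith [hr n, τ.deadline_le_period]
  have hsep : ∀ j k, j < k → r j + τ.deadline ≤ r k := fun j k hjk => by
    linarith [hr j, τ.deadline_le_period, hmono (Nat.succ_le_of_lt hjk)]
  -- The induction must also carry the container deadlines: a finished vertex may still hold its
  -- container, which would hinder the next release.
  have key : ∀ k, r k + τ.deadline ≤ H →
      (∀ v, Finished (upTo log (r k + τ.deadline)) (r k + τ.deadline) k v) ∧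
        ∀ e ∈ log, e.inst = k → e.deadline ≤ r k + τ.deadline := by
    intro k
    induction k using Nat.strong_induction_on with
    | _ k ih =>
    intro hH
    have hrk : r k ≤ r k + τ.deadline := le_add_of_nonneg_right hD
    have hk : ∀ j < k, ∀ u, Finished (upTo log (r k)) (r k) j u := fun j hj u =>
      h.finished_mono (hsep j k hj) ((ih j hj ((hsep j k hj).trans (hrk.trans hH))).1 u)
    have hprev : ∀ e ∈ log, e.inst < k → e.deadline ≤ r k := fun e he hj =>
      ((ih _ hj ((hsep _ k hj).trans (hrk.trans hH))).2 e he rfl).trans (hsep _ k hj)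
    have hdl : ∀ e ∈ log, e.inst = k → e.start ≤ r k + τ.deadline →
        e.deadline ≤ r k + τ.deadline := fun e he hek hes =>
      h.deadline_le_of_bound hanti hδ hD hbound hH hk hprev (fun j hj => hsep k j hj) he hek hes
    have hfin : ∀ v, Finished (upTo log (r k + τ.deadline)) (r k + τ.deadline) k v := by
      intro v
      induction v using τ.wellFounded_edge.induction with
      | _ v ihv =>
      by_contra hnf
      have hparts : PartsDone (upTo log (r k + τ.deadline)) (r k + τ.deadline) k v := by
        intro e he hek _
        rw [mem_upTo] at he
        obtain ⟨past, hdis⟩ := h.exists_isDispatch he.1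
        exact hdis.finish_le_deadline.trans (hdl e he.1 hek he.2)
      refine h.eager _ hH 0 hpos ?_ k v ⟨hrk, fun j hj u => h.finished_mono hrk (hk j hj u),
        fun hf => hnf ⟨hf, hparts⟩, hparts, ihv⟩
      rintro ⟨e, he, -, hs, hd⟩
      rw [mem_upTo] at he
      -- Suppose container 0 were occupied at the deadline. Parts of releases up to `k` have
      -- expired. When the period equals the deadline, a later release may start at this very
      -- instant, but only if release `k` is finished.
      rcases lt_trichotomy e.inst k with h3 | h3 | h3
      · exact absurd ((hprev e he.1 h3).trans hrk) (not_le.2 hd)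
      · exact absurd (hdl e he.1 h3 hs) (not_le.2 hd)
      · exact hnf (h.finished_of_inst_lt he.1 h3 hs v)
    refine ⟨hfin, fun e he hek => hdl e he hek ?_⟩
    exact h.start_le_of_fullyDispatched he (hek ▸ (hfin e.vertex).1)
  intro k hH v
  obtain ⟨hfin, hdl⟩ := key k hH
  obtain ⟨e, he, h1⟩ := (hfin v).1
  refine ⟨⟨e, (mem_upTo.1 he).1, h1⟩, fun e' he' hek _ => ?_⟩
  obtain ⟨past, hdis⟩ := h.exists_isDispatch he'
  exact hdis.finish_le_deadline.trans (hdl e' he' hek)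

end Execution

/-! ### Uniformity of the given load bounds -/

section DividedLoads

variable {n : ℕ} {a b : ℝ}

theorem dividedLoads_castSucc_castSucc (i : Fin n) :
    dividedLoads n a b i.castSucc.castSucc = 1 := by
  simp [dividedLoads]

theorem dividedLoads_castSucc_last : dividedLoads n a b (Fin.last n).castSucc = a := by
  simp [dividedLoads]

theorem dividedLoads_last : dividedLoads n a b (Fin.last (n + 1)) = b := by
  simp [dividedLoads]

theorem totalSpeed_dividedLoads : totalSpeed (dividedLoads n a b) = n + a + b := by
  simp [totalSpeed, Fin.sum_univ_castSucc, dividedLoads_castSucc_castSucc,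
    dividedLoads_castSucc_last, dividedLoads_last]

theorem antitone_dividedLoads (ha : a ≤ 1) (hba : b ≤ a) : Antitone (dividedLoads n a b) := by
  intro p q hpq
  have : p.val ≤ q.val := hpq
  unfold dividedLoads
  split_ifs <;> first | omega | linarith

theorem dividedLoads_nonneg (ha : 0 ≤ a) (hb : 0 ≤ b) (p : Fin (n + 2)) :
    0 ≤ dividedLoads n a b p := by
  unfold dividedLoads
  split_ifs <;> first | assumption | exact zero_le_one

theorem prefixSpeed_dividedLoads_of_lt {p : Fin (n + 2)} (hp : p.val < n) :
    prefixSpeed (dividedLoads n a b) p = p.val + 1 := by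
  rw [prefixSpeed, Finset.sum_congr rfl (g := fun _ => (1 : ℝ))]
  · simp
  · intro j hj
    have : j.val ≤ p.val := Fin.le_def.1 (Finset.mem_Iic.1 hj)
    simp [dividedLoads, this.trans_lt hp]

theorem totalSpeed_sub_prefixSpeed_dividedLoads {p : Fin (n + 2)} (hp : p.val = n) :
    totalSpeed (dividedLoads n a b) - prefixSpeed (dividedLoads n a b) p = b := by
  obtain rfl : p = (Fin.last n).castSucc := Fin.ext hp
  have hI : (Finset.univ : Finset (Fin (n + 2))) =
      insert (Fin.last (n + 1)) (Finset.Iic (Fin.last n).castSucc) := by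
    ext j
    rcases Fin.eq_castSucc_or_eq_last j with ⟨i, rfl⟩ | rfl <;> simp [Fin.le_last]
  rw [totalSpeed, hI, Finset.sum_insert (by simp), prefixSpeed,
    add_sub_cancel_right, dividedLoads_last]

/-- On the dedicated processors the quotient decreases by 1 per index, so index 0 attains the
maximum. `hba` says that the quotient `b / a` at index `n` does not exceed it. -/
theorem uniformity_dividedLoads (hn : 0 < n) (ha : 0 ≤ a) (hγ : 1 ≤ n + a + b)
    (hba : b ≤ (n + a + b - 1) * a) :
    uniformity (dividedLoads n a b) = n + a + b - 1 := by
  refine le_antisymm (Finset.sup'_le _ _ fun p _ => ?_) ?_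
  · rcases lt_trichotomy p.val n with hp | hp | hp
    · rw [prefixSpeed_dividedLoads_of_lt hp, totalSpeed_dividedLoads, dividedLoads, if_pos hp]
      have : (0 : ℝ) ≤ p.val := Nat.cast_nonneg _
      linarith
    · rw [totalSpeed_sub_prefixSpeed_dividedLoads hp, dividedLoads, if_neg hp.not_lt, if_pos hp]
      -- This also covers `a = 0`, where the quotient is 0 by convention.
      exact div_le_of_le_mul₀ ha (by linarith) hba
    · obtain rfl : p = Fin.last (n + 1) := Fin.ext (by simp; omega)
      have : prefixSpeed (dividedLoads n a b) (Fin.last (n + 1)) =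
          totalSpeed (dividedLoads n a b) := by
        rw [prefixSpeed, totalSpeed, ← Fin.top_eq_last, Finset.Iic_top]
      rw [this, sub_self, zero_div]
      linarith
  · refine le_trans (le_of_eq ?_) (Finset.le_sup' _ (Finset.mem_univ 0))
    rw [prefixSpeed_dividedLoads_of_lt (by simpa using hn), totalSpeed_dividedLoads, dividedLoads,
      if_pos (by simpa using hn)]
    simp

end DividedLoads

end SemiFed

theorem lemmal {V : Type*} [Fintype V] (τ : SemiFed.DAGTask V)
    (hheavy : τ.IsHeavy) (hL : τ.longestPath < τ.deadline)
    (δ' δ'' : ℝ) (hδ'' : 0 ≤ δ'')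
    (hsum : δ' + δ'' = τ.minCapacity - ⌊τ.minCapacity⌋₊)
    (hδ' : max ((τ.minCapacity - ⌊τ.minCapacity⌋₊) / 2)
      ((τ.minCapacity - ⌊τ.minCapacity⌋₊) / τ.minCapacity) ≤ δ') :
    SemiFed.uniformity (SemiFed.dividedLoads ⌊τ.minCapacity⌋₊ δ' δ'') = τ.minCapacity - 1 ∧
    (τ.totalWork +
        SemiFed.uniformity (SemiFed.dividedLoads ⌊τ.minCapacity⌋₊ δ' δ'') * τ.longestPath) /
      SemiFed.totalSpeed (SemiFed.dividedLoads ⌊τ.minCapacity⌋₊ δ' δ'') = τ.deadline ∧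
    SemiFed.Schedulable τ (SemiFed.dividedLoads ⌊τ.minCapacity⌋₊ δ' δ'') := by
  have hL0 := τ.longestPath_nonneg
  have hDL := sub_pos.2 hL
  have hD : 0 < τ.deadline := hL0.trans_lt hL
  have hC : τ.deadline < τ.totalWork := (one_lt_div hD).1 hheavy
  have hγ : 1 < τ.minCapacity := (one_lt_div hDL).2 (by linarith)
  have hγD : τ.minCapacity * (τ.deadline - τ.longestPath) = τ.totalWork - τ.longestPath :=
    div_mul_cancel₀ _ hDL.ne'
  set γ := τ.minCapacity
  have hn : 0 < ⌊γ⌋₊ := Nat.floor_pos.2 hγ.le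
  have hfl : (⌊γ⌋₊ : ℝ) ≤ γ := Nat.floor_le (by linarith)
  have hfl' : γ < ⌊γ⌋₊ + 1 := Nat.lt_floor_add_one γ
  obtain ⟨h2, hdiv⟩ := max_le_iff.1 hδ'
  rw [div_le_iff₀ (by linarith)] at hdiv
  have ha : 0 ≤ δ' := by linarith
  have hS : ⌊γ⌋₊ + δ' + δ'' = γ := by linarith
  -- By `hdiv`, δ' + δ'' ≤ δ'γ, which is δ'' ≤ (γ - 1)δ'. The other bound `h2` gives δ'' ≤ δ',
  -- needed for the non-increasing order.
  have hU := SemiFed.uniformity_dividedLoads (b := δ'') hn ha (by linarith)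
    (by rw [hS]; linarith)
  have hT := SemiFed.totalSpeed_dividedLoads (n := ⌊γ⌋₊) (a := δ') (b := δ'')
  rw [hS] at hU hT
  have hbound : τ.totalWork + (γ - 1) * τ.longestPath = γ * τ.deadline := by linarith
  refine ⟨hU, ?_, ?_⟩
  · rw [hU, hT, hbound, mul_div_cancel_left₀ _ (by linarith)]
  · refine SemiFed.schedulable_of_bound (SemiFed.antitone_dividedLoads (by linarith) (by linarith))
      (SemiFed.dividedLoads_nonneg ha hδ'') ?_ hD.le ?_
    · simp [SemiFed.dividedLoads, hn]
    · rw [hU, hT, hbound]
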